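/- Let $\mathcal X,\mathcal Y$ be finite alphabets and let $(X_1,Y_1),(X_2,Y_2),\dots$ be i.i.d. with common law $P_{XY}$ satisfying the positivity condition $P_{XY}(a,b)>0$ for all $(a,b)\in\mathcal X\times\mathcal Y$. All logarithms are to base 2, and $H(X|Y)$ is the conditional entropy. Let $\mathbf f=\{f_n\}_{n\ge1}$ be functions $f_n\colon\mathcal X^n\times\mathcal Y^n\to\mathcal Z_n$ such that every $f_n$ is sensitive conditioned on $\mathcal Y^n$: whenever $f_n(\mathbf x,\mathbf y)=f_n(\hat{\mathbf x},\mathbf y)$ and $x_i\ne\hat x_i$ for some $i$, there is $\hat{\mathbf y}\in\mathcal Y^n$ with $\hat y_i\neq y_i$, $\hat y_j=y_j$ for all $j\ne i$, and $f_n(\mathbf x,\hat{\mathbf y})\ne f_n(\hat{\mathbf x},\hat{\mathbf y})$. A (variable-length) code $\Phi_n=(\varphi_n,\psi_n)$ with full side-information consists of an encoder $\varphi_n\colon\mathcal X^n\to\{0,1\}^*$ whose set of codewords $\mathcal C_n=\varphi_n(\mathcal X^n)$ satisfies the prefix condition (no codeword is a proper prefix of another), and a decoder $\psi_n\colon\mathcal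 C_n\times\mathcal Y^n\to\mathcal Z_n$. It is a fixed-length code if all codewords have the same length. Its error probability is $\mathrm P_{\mathrm e}(\Phi_n|f_n)=\Pr\{f_n(X^n,Y^n)\ne\psi_n(\varphi_n(X^n),Y^n)\}$. For $t\in(0,1/2)$ and $\gamma>0$ define \[ e^{\mathrm{vl}}(t,\gamma|\mathbf f)=\sup_{\{\Phi_n\}}\ \liminf_{n\to\infty}\,-\frac1{n^{1-2t}}\log \mathrm P_{\mathrm e}(\Phi_n|f_n)\in[0,\infty], \] with $-\log 0=+\infty$, where the supremum is over all sequences of codes for computing $\mathbf f$ with \[ \limsup_{n\to\infty}\frac1{n^{1-t}}\bigl(\mathbb E|\varphi_n(X^n)|-nH(X|Y)\bigr)\le\gamma , \] and let $e^{\mathrm{fl}}(t,\gamma|\mathbf f)$ be the same supremum restricted to sequences of fixed-length codes. Let $e^{\mathrm{vl}}_{\mathrm{SW}}(t,\gamma)$ and $e^{\mathrm{fl}}_{\mathrm{SW}}(t,\gamma)$ be these exponents (Slepian–Wolf coding) for the identity functions $f_n^{\mathrm{id}}(\mathbf x,\mathbf y)=(\mathbf x,\mathbf y)$. Then, for every $t\in(0,1/2)$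 and $\gamma>0$, \[ e^{\mathrm{fl}}(t,\gamma|\mathbf f)=e^{\mathrm{fl}}_{\mathrm{SW}}(t,\gamma),\qquad e^{\mathrm{vl}}(t,\gamma|\mathbf f)=e^{\mathrm{vl}}_{\mathrm{SW}}(t,\gamma). \] -/

import Mathlib

noncomputable section

namespace SideInfo

/-- `f : 𝒳ⁿ × 𝒴ⁿ → 𝒵` is sensitive conditioned on `𝒴ⁿ`: whenever `f (x, y) = f (x', y)` and
`x i ≠ x' i`, one can change `y` in the `i`-th coordinate only so that the values of `f`
become different. -/
def Sensitive {X Y Z : Type*} {n : ℕ} (f : (Fin n → X) → (Fin n → Y) → Z) : Prop :=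
  ∀ (x x' : Fin n → X) (y : Fin n → Y) (i : Fin n), f x y = f x' y → x i ≠ x' i →
    ∃ y' : Fin n → Y, y' i ≠ y i ∧ (∀ j, j ≠ i → y' j = y j) ∧ f x y' ≠ f x' y'

/-- A variable-length code of block length `n` with full side-information: an encoder into
finite binary strings whose set of codewords satisfies the prefix condition, and a decoder that
observes the codeword and the whole side-information sequence. -/
structure Code (X Y : Type*) (n : ℕ) (Z : Type*) where
  enc : (Fin n → X) → List Bool
  prefix_cond : ∀ c ∈ Set.range enc, ∀ c' ∈ Set.range enc, c <+: c' → c = c'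
  dec : Set.range enc → (Fin n → Y) → Z

/-- All codewords have the same length. -/
def Code.IsFixedLength {X Y Z : Type*} {n : ℕ} (Φ : Code X Y n Z) : Prop :=
  ∃ l : ℕ, ∀ c ∈ Set.range Φ.enc, c.length = l

/-- The value decoded when the source emits `x` and the side-information is `y`. -/
def Code.output {X Y Z : Type*} {n : ℕ} (Φ : Code X Y n Z) (x : Fin n → X) (y : Fin n → Y) : Z :=
  Φ.dec ⟨Φ.enc x, Set.mem_range_self x⟩ y

/-- The i.i.d. law `P_{XⁿYⁿ}(x, y) = ∏ i, P_{XY}(x i, y i)`. -/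
def blockProb {X Y : Type*} (P : PMF (X × Y)) {n : ℕ} (x : Fin n → X) (y : Fin n → Y) : ℝ :=
  ∏ i, (P (x i, y i)).toReal

/-- The conditional entropy `H(X|Y)` in bits. -/
def condEntropy {X Y : Type*} [Fintype X] [Fintype Y] (P : PMF (X × Y)) : ℝ :=
  ∑ x, ∑ y, (P (x, y)).toReal * Real.logb 2 ((∑ x', (P (x', y)).toReal) / (P (x, y)).toReal)

/-- The average codeword length `E |φ(Xⁿ)|`. -/
def avgLength {X Y Z : Type*} [Fintype X] [Fintype Y] (P : PMF (X × Y)) {n : ℕ}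
    (Φ : Code X Y n Z) : ℝ :=
  ∑ x : Fin n → X, (∑ y : Fin n → Y, blockProb P x y) * ((Φ.enc x).length : ℝ)

open Classical in
/-- The error probability `Pr {f (Xⁿ, Yⁿ) ≠ ψ (φ (Xⁿ), Yⁿ)}`. -/
def errorProb {X Y Z : Type*} [Fintype X] [Fintype Y] (P : PMF (X × Y)) {n : ℕ}
    (Φ : Code X Y n Z) (f : (Fin n → X) → (Fin n → Y) → Z) : ℝ :=
  ∑ x : Fin n → X, ∑ y : Fin n → Y, if f x y ≠ Φ.output x y then blockProb P x y else 0

/-- `-log₂ p` for a probability `p`, with the value `+∞` at `p = 0`. -/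
def negLog (p : ℝ) : EReal :=
  if p = 0 then ⊤ else ((-Real.logb 2 p : ℝ) : EReal)

/-- `limsup n^{-(1-t)} (E |φ_n(Xⁿ)| - n H(X|Y)) ≤ γ`. -/
def RateConstraint {X Y : Type*} [Fintype X] [Fintype Y] (P : PMF (X × Y)) (t γ : ℝ)
    {Z : ℕ → Type*} (Φ : ∀ n, Code X Y n (Z n)) : Prop :=
  Filter.limsup (fun n : ℕ =>
      ((1 / (n : ℝ) ^ (1 - t) * (avgLength P (Φ n) - n * condEntropy P) : ℝ) : EReal))
    Filter.atTop ≤ (γ : EReal)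

/-- `liminf -n^{-(1-2t)} log P_e(Φ_n | f_n)` of a sequence of codes. -/
def codeExponent {X Y : Type*} [Fintype X] [Fintype Y] (P : PMF (X × Y)) (t : ℝ)
    {Z : ℕ → Type*} (f : ∀ n, (Fin n → X) → (Fin n → Y) → Z n)
    (Φ : ∀ n, Code X Y n (Z n)) : EReal :=
  Filter.liminf (fun n : ℕ =>
      ((1 / (n : ℝ) ^ (1 - 2 * t) : ℝ) : EReal) * negLog (errorProb P (Φ n) (f n)))
    Filter.atTop

/-- The optimal moderate-deviation exponent for variable-length codes: the best exponent over all
sequences of codes that satisfy the rate constraint. -/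
def exponentVL {X Y : Type*} [Fintype X] [Fintype Y] (P : PMF (X × Y)) (t γ : ℝ)
    {Z : ℕ → Type*} (f : ∀ n, (Fin n → X) → (Fin n → Y) → Z n) : EReal :=
  sSup {e : EReal | ∃ Φ : ∀ n, Code X Y n (Z n),
    RateConstraint P t γ Φ ∧ e = codeExponent P t f Φ}

/-- The optimal moderate-deviation exponent for fixed-length codes. -/
def exponentFL {X Y : Type*} [Fintype X] [Fintype Y] (P : PMF (X × Y)) (t γ : ℝ)
    {Z : ℕ → Type*} (f : ∀ n, (Fin n → X) → (Fin n → Y) → Z n) : EReal :=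
  sSup {e : EReal | ∃ Φ : ∀ n, Code X Y n (Z n),
    (∀ n, (Φ n).IsFixedLength) ∧ RateConstraint P t γ Φ ∧ e = codeExponent P t f Φ}

/-- The sequence of identity functions `(x, y) ↦ (x, y)`; codes for it are Slepian–Wolf codes. -/
def idFun (X Y : Type*) (n : ℕ) (x : Fin n → X) (y : Fin n → Y) : (Fin n → X) × (Fin n → Y) :=
  (x, y)

/-- The Slepian–Wolf exponent for variable-length codes. -/
def exponentSWVL {X Y : Type*} [Fintype X] [Fintype Y] (P : PMF (X × Y)) (t γ : ℝ) : EReal :=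
  exponentVL P t γ (idFun X Y)

/-- The Slepian–Wolf exponent for fixed-length codes. -/
def exponentSWFL {X Y : Type*} [Fintype X] [Fintype Y] (P : PMF (X × Y)) (t γ : ℝ) : EReal :=
  exponentFL P t γ (idFun X Y)

end SideInfo

end

namespace SideInfo

open Filter Topology

variable {X Y : Type*}

/-! A Slepian–Wolf code computes `f` by applying `f` to its output. Conversely, keep the encoder of
a code for `f` and change only the decoder. If `x` and `x'` share a codeword and both are decoded
correctly at `y` and at all its one-coordinate modifications, sensitivity forces `x = x'`, so `x`
can be recovered (`RobustlyCorrect.unique`). The new decoder thus fails at `(x, y)` only if the old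
one fails there or at a one-coordinate modification of `y`. By positivity such a modification costs
a constant factor in probability, and there are `O(n)` of them, so the error grows at most linearly
in `n` (`errorProb_toSlepianWolf_le`). After division by `n^(1-2t)` with `t < 1/2`, the logarithm of
that factor vanishes. -/

lemma blockProb_nonneg (P : PMF (X × Y)) {n : ℕ} (x : Fin n → X) (y : Fin n → Y) :
    0 ≤ blockProb P x y :=
  Finset.prod_nonneg fun _ _ => ENNReal.toReal_nonneg

lemma errorProb_nonneg [Fintype X] [Fintype Y] (P : PMF (X × Y)) {n : ℕ} {Z : Type*}
    (Φ : Code X Y n Z) (f : (Fin n → X) → (Fin n → Y) → Z) : 0 ≤ errorProb P Φ f := by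
  refine Finset.sum_nonneg fun x _ => Finset.sum_nonneg fun y _ => ?_
  split_ifs
  exacts [blockProb_nonneg P x y, le_rfl]

/-- The error probability is monotone with respect to inclusion of error events. -/
lemma errorProb_mono [Fintype X] [Fintype Y] (P : PMF (X × Y)) {n : ℕ} {Z W : Type*}
    (Φ : Code X Y n Z) (f : (Fin n → X) → (Fin n → Y) → Z)
    (Ψ : Code X Y n W) (g : (Fin n → X) → (Fin n → Y) → W)
    (h : ∀ x y, f x y = Φ.output x y → g x y = Ψ.output x y) :
    errorProb P Ψ g ≤ errorProb P Φ f := by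
  refine Finset.sum_le_sum fun x _ => Finset.sum_le_sum fun y _ => ?_
  by_cases hf : f x y = Φ.output x y
  · simp [hf, h x y hf]
  · rw [if_pos hf]
    split_ifs
    exacts [le_rfl, blockProb_nonneg P x y]

/-- Post-process the output of a Slepian–Wolf code by a function. -/
def Code.postcomp {n : ℕ} {Z W : Type*} (Φ : Code X Y n Z) (h : Z → W) : Code X Y n W where
  enc := Φ.enc
  prefix_cond := Φ.prefix_cond
  dec c y := h (Φ.dec c y)

/-- The decoder is correct at `(x, y)` and after any change of a single coordinate of `y`. -/
def RobustlyCorrect {n : ℕ} {Z : Type*} (Φ : Code X Y n Z)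
    (f : (Fin n → X) → (Fin n → Y) → Z) (x : Fin n → X) (y : Fin n → Y) : Prop :=
  f x y = Φ.output x y ∧
    ∀ i b, f x (Function.update y i b) = Φ.output x (Function.update y i b)

lemma Code.output_congr {n : ℕ} {Z : Type*} (Φ : Code X Y n Z) {x x' : Fin n → X}
    (h : Φ.enc x = Φ.enc x') (y : Fin n → Y) : Φ.output x y = Φ.output x' y := by
  unfold Code.output
  congr 1
  exact Subtype.ext h

/-- For a sensitive function, the source sequence is determined by its codeword and any
side-information sequence at which it is decoded robustly. -/
lemma RobustlyCorrect.unique {n : ℕ} {Z : Type*} {Φ : Code X Y n Z}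
    {f : (Fin n → X) → (Fin n → Y) → Z} (hf : Sensitive f) {x x' : Fin n → X} {y : Fin n → Y}
    (hx : RobustlyCorrect Φ f x y) (hx' : RobustlyCorrect Φ f x' y)
    (h : Φ.enc x = Φ.enc x') : x = x' := by
  by_contra hne
  obtain ⟨i, hi⟩ := Function.ne_iff.mp hne
  have hxy : f x y = f x' y := by rw [hx.1, hx'.1, Φ.output_congr h]
  obtain ⟨y', -, hj, hy'⟩ := hf x x' y i hxy hi
  have hup : y' = Function.update y i (y' i) :=
    (Function.update_eq_iff.mpr ⟨rfl, fun j hji => (hj j hji).symm⟩).symm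
  -- At `y'` too, both values of `f` equal the single decoder output for the common codeword.
  apply hy'
  rw [hup, hx.2, hx'.2, Φ.output_congr h]

open Classical in
/-- The Slepian–Wolf code with the same encoder as `Φ`, which decodes to a source sequence that has
the received codeword and at which `Φ` is robustly correct, if there is one. -/
noncomputable def Code.toSlepianWolf {n : ℕ} {Z : Type*} (Φ : Code X Y n Z)
    (f : (Fin n → X) → (Fin n → Y) → Z) : Code X Y n ((Fin n → X) × (Fin n → Y)) where
  enc := Φ.enc
  prefix_cond := Φ.prefix_cond
  dec c y :=
    -- The fallback is an arbitrary preimage of the codeword; the error bound never relies on it.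
    if h : ∃ x, Φ.enc x = c ∧ RobustlyCorrect Φ f x y then (h.choose, y) else (c.2.choose, y)

lemma Code.toSlepianWolf_output {n : ℕ} {Z : Type*} (Φ : Code X Y n Z)
    {f : (Fin n → X) → (Fin n → Y) → Z} (hf : Sensitive f) {x : Fin n → X} {y : Fin n → Y}
    (hx : RobustlyCorrect Φ f x y) : idFun X Y n x y = (Φ.toSlepianWolf f).output x y := by
  have h : ∃ x', Φ.enc x' = Φ.enc x ∧ RobustlyCorrect Φ f x' y := ⟨x, rfl, hx⟩
  have hd : (Φ.toSlepianWolf f).output x y = (h.choose, y) := dif_pos h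
  exact (congrArg (·, y) (hx.unique hf h.choose_spec.2 h.choose_spec.1.symm)).trans hd.symm

/-- Exchanging a coordinate of a sequence with a separate symbol. -/
def swapCoord {n : ℕ} (i : Fin n) : ((Fin n → Y) × Y) ≃ ((Fin n → Y) × Y) :=
  Function.Involutive.toPerm (fun p => (Function.update p.1 i p.2, p.1 i)) fun p => by simp

/-- Every sequence arises as an update at `i` from exactly `Fintype.card Y` pairs `(y, b)`, since
the pair can be recovered from the new sequence and the overwritten symbol. -/
lemma sum_sum_update [Fintype Y] {n : ℕ} (i : Fin n) (g : (Fin n → Y) → ℝ) :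
    ∑ y : Fin n → Y, ∑ b : Y, g (Function.update y i b) = Fintype.card Y * ∑ y, g y := by
  rw [← Fintype.sum_prod_type' (f := fun y b => g (Function.update y i b))]
  refine ((swapCoord i).sum_comp (fun p : (Fin n → Y) × Y => g p.1)).trans ?_
  simp [Fintype.sum_prod_type, Finset.mul_sum]

/-- Changing one coordinate of the side-information changes the probability at most by a constant
factor. -/
lemma blockProb_le_mul_update [Fintype X] [Fintype Y] (P : PMF (X × Y))
    (hP : ∀ (a : X) (b : Y), 0 < P (a, b)) {n : ℕ} (x : Fin n → X) (y : Fin n → Y) (i : Fin n)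
    (b : Y) : blockProb P x y ≤
      (∑ p, ((P p).toReal)⁻¹) * blockProb P x (Function.update y i b) := by
  have hpos : 0 < (P (x i, b)).toReal := ENNReal.toReal_pos (hP _ _).ne' (P.apply_ne_top _)
  -- The sum of all inverse probabilities dominates each one, giving a constant independent of `n`,
  -- `x`, `y`, `i` and `b`.
  have hle : (P (x i, y i)).toReal ≤ (∑ p, ((P p).toReal)⁻¹) * (P (x i, b)).toReal := by
    calc (P (x i, y i)).toReal ≤ 1 := ENNReal.toReal_le_of_le_ofReal zero_le_one
            (by simpa using P.coe_le_one _)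
      _ = ((P (x i, b)).toReal)⁻¹ * (P (x i, b)).toReal := (inv_mul_cancel₀ hpos.ne').symm
      _ ≤ _ := mul_le_mul_of_nonneg_right
            (Finset.single_le_sum (f := fun p => ((P p).toReal)⁻¹)
              (fun p _ => inv_nonneg.mpr ENNReal.toReal_nonneg) (Finset.mem_univ _)) hpos.le
  unfold blockProb
  rw [← Finset.mul_prod_erase _ _ (Finset.mem_univ i),
    ← Finset.mul_prod_erase _ (fun j => (P (x j, Function.update y i b j)).toReal)
      (Finset.mem_univ i), ← mul_assoc, Function.update_self]
  have hrest : ∏ j ∈ Finset.univ.erase i, (P (x j, Function.update y i b j)).toReal =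
      ∏ j ∈ Finset.univ.erase i, (P (x j, y j)).toReal :=
    Finset.prod_congr rfl fun j hj => by
      rw [Function.update_of_ne (Finset.ne_of_mem_erase hj)]
  rw [hrest]
  exact mul_le_mul_of_nonneg_right hle (Finset.prod_nonneg fun _ _ => ENNReal.toReal_nonneg)

/-- Turning a code for a sensitive function into a Slepian–Wolf code with the same encoder
increases the error probability at most by a factor linear in the block length. -/
lemma errorProb_toSlepianWolf_le [Fintype X] [Fintype Y] (P : PMF (X × Y))
    (hP : ∀ (a : X) (b : Y), 0 < P (a, b)) {n : ℕ} {Z : Type*} (Φ : Code X Y n Z)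
    {f : (Fin n → X) → (Fin n → Y) → Z} (hf : Sensitive f) :
    errorProb P (Φ.toSlepianWolf f) (idFun X Y n) ≤
      (1 + n * ((∑ p, ((P p).toReal)⁻¹) * Fintype.card Y)) * errorProb P Φ f := by
  classical
  set K : ℝ := ∑ p, ((P p).toReal)⁻¹
  have hK : 0 ≤ K := Finset.sum_nonneg fun p _ => inv_nonneg.mpr ENNReal.toReal_nonneg
  let e : (Fin n → X) → (Fin n → Y) → ℝ := fun x y =>
    if f x y ≠ Φ.output x y then blockProb P x y else 0
  have he : ∀ x y, 0 ≤ e x y := fun x y => by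
    simp only [e]
    split_ifs
    exacts [blockProb_nonneg P x y, le_rfl]
  have hE : errorProb P Φ f = ∑ x, ∑ y, e x y := by
    unfold errorProb
    refine Finset.sum_congr rfl fun x _ => Finset.sum_congr rfl fun y _ => ?_
    simp only [e]
  -- A pointwise union bound: a new error is charged to an old error at `y` or at some modification
  -- of `y`.
  have hpt : ∀ x y, (if idFun X Y n x y ≠ (Φ.toSlepianWolf f).output x y
      then blockProb P x y else 0) ≤
        e x y + K * ∑ i, ∑ b, e x (Function.update y i b) := by
    intro x y
    have hs : ∀ i, 0 ≤ ∑ b, e x (Function.update y i b) :=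
      fun i => Finset.sum_nonneg fun b _ => he _ _
    have hss : 0 ≤ K * ∑ i, ∑ b, e x (Function.update y i b) :=
      mul_nonneg hK (Finset.sum_nonneg fun i _ => hs i)
    split_ifs with herr
    · by_cases h0 : f x y = Φ.output x y
      · have hnr : ¬ RobustlyCorrect Φ f x y := fun hr => herr (Φ.toSlepianWolf_output hf hr)
        have hex : ∃ i b, f x (Function.update y i b) ≠ Φ.output x (Function.update y i b) := by
          by_contra! hcon
          exact hnr ⟨h0, hcon⟩
        obtain ⟨i, b, hib⟩ := hex
        have heq : e x (Function.update y i b) = blockProb P x (Function.update y i b) :=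
          if_pos hib
        calc blockProb P x y ≤ K * e x (Function.update y i b) := by
              rw [heq]
              exact blockProb_le_mul_update P hP x y i b
          _ ≤ K * ∑ i, ∑ b, e x (Function.update y i b) := by
              refine mul_le_mul_of_nonneg_left ?_ hK
              exact (Finset.single_le_sum (f := fun b => e x (Function.update y i b))
                (fun b _ => he _ _) (Finset.mem_univ b)).trans
                (Finset.single_le_sum (f := fun i => ∑ b, e x (Function.update y i b))
                  (fun i _ => hs i) (Finset.mem_univ i))
          _ ≤ _ := le_add_of_nonneg_left (he _ _)
      · have heq : e x y = blockProb P x y := if_pos h0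
        rw [heq]
        exact le_add_of_nonneg_right hss
    · exact add_nonneg (he _ _) hss
  have hrow : ∀ x, ∑ y, (e x y + K * ∑ i, ∑ b, e x (Function.update y i b)) =
      (1 + n * (K * Fintype.card Y)) * ∑ y, e x y := by
    intro x
    rw [Finset.sum_add_distrib, ← Finset.mul_sum, Finset.sum_comm]
    simp only [sum_sum_update]
    simp
    ring
  rw [hE, Finset.mul_sum]
  unfold errorProb
  refine Finset.sum_le_sum fun x _ => ?_
  rw [← hrow]
  refine Finset.sum_le_sum fun y _ => le_trans (le_of_eq ?_) (hpt x y)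
  congr

/-- For `n ≥ 1`, `1 + n * A ≤ (1 + A) * n`, and `log n` is negligible against `n ^ s`. -/
lemma tendsto_logb_linear_div_rpow {A s : ℝ} (hA : 0 ≤ A) (hs : 0 < s) :
    Tendsto (fun n : ℕ => 1 / (n : ℝ) ^ s * Real.logb 2 (1 + n * A)) atTop (𝓝 0) := by
  have h1 : Tendsto (fun n : ℕ => Real.logb 2 (1 + A) * ((n : ℝ) ^ s)⁻¹ +
      (Real.log 2)⁻¹ * (Real.log n / (n : ℝ) ^ s)) atTop (𝓝 0) := by
    have ha := ((tendsto_rpow_atTop hs).comp tendsto_natCast_atTop_atTop).inv_tendsto_atTop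
    have hb := ((isLittleO_log_rpow_atTop hs).tendsto_div_nhds_zero).comp
      (tendsto_natCast_atTop_atTop (R := ℝ))
    simpa using (ha.const_mul (Real.logb 2 (1 + A))).add (hb.const_mul (Real.log 2)⁻¹)
  refine tendsto_of_tendsto_of_tendsto_of_le_of_le' tendsto_const_nhds h1 ?_ ?_
  · filter_upwards with n
    have : 0 ≤ (n : ℝ) * A := by positivity
    exact mul_nonneg (by positivity) (Real.logb_nonneg one_lt_two (by linarith))
  · filter_upwards [eventually_ge_atTop 1] with n hn
    have hn' : (1 : ℝ) ≤ n := by exact_mod_cast hn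
    have hlog : Real.logb 2 (1 + n * A) ≤ Real.logb 2 (1 + A) + Real.logb 2 n := by
      rw [← Real.logb_mul (by positivity) (by positivity)]
      refine Real.logb_le_logb_of_le one_lt_two (by positivity) ?_
      linarith
    calc 1 / (n : ℝ) ^ s * Real.logb 2 (1 + n * A)
        ≤ 1 / (n : ℝ) ^ s * (Real.logb 2 (1 + A) + Real.logb 2 n) :=
          mul_le_mul_of_nonneg_left hlog (by positivity)
      _ = _ := by
          rw [← Real.log_div_log (b := 2) (x := (n : ℝ))]
          ring

lemma mul_negLog_le {p q c d : ℝ} (hc : 0 < c) (hd : 0 < d) (hp : 0 ≤ p) (hq : 0 ≤ q)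
    (h : q ≤ c * p) :
    (d : EReal) * negLog p ≤ d * negLog q + ((d * Real.logb 2 c : ℝ) : EReal) := by
  by_cases hq0 : q = 0
  · have : (d : EReal) * negLog q + ((d * Real.logb 2 c : ℝ) : EReal) = ⊤ := by
      rw [negLog, if_pos hq0, EReal.coe_mul_top_of_pos hd, EReal.top_add_coe]
    rw [this]
    exact le_top
  · have hq' : 0 < q := lt_of_le_of_ne hq (Ne.symm hq0)
    have hp0 : p ≠ 0 := by
      rintro rfl
      simp only [mul_zero] at h
      exact absurd hq' h.not_gt
    rw [negLog, negLog, if_neg hq0, if_neg hp0]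
    norm_cast
    have hl : Real.logb 2 q ≤ Real.logb 2 c + Real.logb 2 p := by
      rw [← Real.logb_mul hc.ne' hp0]
      exact Real.logb_le_logb_of_le one_lt_two hq' h
    nlinarith

/-- A factor linear in the block length does not affect the error exponent. -/
lemma codeExponent_le_of_errorProb_le [Fintype X] [Fintype Y] (P : PMF (X × Y)) {t A : ℝ}
    (ht : t < 1 / 2) (hA : 0 ≤ A) {Z W : ℕ → Type*}
    {f : ∀ n, (Fin n → X) → (Fin n → Y) → Z n} {g : ∀ n, (Fin n → X) → (Fin n → Y) → W n}
    {Φ : ∀ n, Code X Y n (Z n)} {Ψ : ∀ n, Code X Y n (W n)}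
    (h : ∀ n, 1 ≤ n → errorProb P (Ψ n) (g n) ≤ (1 + n * A) * errorProb P (Φ n) (f n)) :
    codeExponent P t f Φ ≤ codeExponent P t g Ψ := by
  set v : ℕ → EReal := fun n =>
    ((1 / (n : ℝ) ^ (1 - 2 * t) : ℝ) : EReal) * negLog (errorProb P (Ψ n) (g n)) with hv
  set w : ℕ → EReal := fun n =>
    ((1 / (n : ℝ) ^ (1 - 2 * t) * Real.logb 2 (1 + n * A) : ℝ) : EReal) with hw
  have hw0 : limsup w atTop = 0 :=
    ((continuous_coe_real_ereal.tendsto 0).comp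
      (tendsto_logb_linear_div_rpow hA (by linarith))).limsup_eq
  have huv : ∀ᶠ n : ℕ in atTop,
      ((1 / (n : ℝ) ^ (1 - 2 * t) : ℝ) : EReal) * negLog (errorProb P (Φ n) (f n)) ≤
        (v + w) n := by
    -- At `n = 0` the scaling factor `1 / n ^ (1 - 2 * t)` would be `0`, not positive.
    filter_upwards [eventually_ge_atTop 1] with n hn
    have hn' : (0 : ℝ) < n := by exact_mod_cast hn
    have hc : 0 < 1 + (n : ℝ) * A := by positivity
    have hd : 0 < 1 / (n : ℝ) ^ (1 - 2 * t) := by positivity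
    exact mul_negLog_le hc hd (errorProb_nonneg P (Φ n) (f n))
      (errorProb_nonneg P (Ψ n) (g n)) (h n hn)
  calc codeExponent P t f Φ ≤ liminf (v + w) atTop := liminf_le_liminf huv
    _ = liminf (w + v) atTop := by rw [add_comm]
    _ ≤ limsup w atTop + liminf v atTop := by
        -- The side conditions exclude `⊤ + ⊥`; they hold because the limsup of `w` is finite.
        refine EReal.liminf_add_le ?_ ?_ <;> simp [hw0]
    _ = codeExponent P t g Ψ := by
        rw [hw0, zero_add]
        rfl

lemma codeExponent_toSlepianWolf [Fintype X] [Fintype Y] (P : PMF (X × Y))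
    (hP : ∀ (a : X) (b : Y), 0 < P (a, b)) {Z : ℕ → Type*}
    {f : ∀ n, (Fin n → X) → (Fin n → Y) → Z n} (hf : ∀ n, 1 ≤ n → Sensitive (f n))
    {t : ℝ} (ht : t < 1 / 2) (Φ : ∀ n, Code X Y n (Z n)) :
    codeExponent P t f Φ ≤
      codeExponent P t (idFun X Y) (fun n => (Φ n).toSlepianWolf (f n)) :=
  codeExponent_le_of_errorProb_le P ht
    (mul_nonneg (Finset.sum_nonneg fun _ _ => inv_nonneg.mpr ENNReal.toReal_nonneg)
      (Nat.cast_nonneg _))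
    fun n hn => errorProb_toSlepianWolf_le P hP (Φ n) (hf n hn)

lemma codeExponent_postcomp [Fintype X] [Fintype Y] (P : PMF (X × Y)) {Z : ℕ → Type*}
    (f : ∀ n, (Fin n → X) → (Fin n → Y) → Z n) {t : ℝ} (ht : t < 1 / 2)
    (Φ : ∀ n, Code X Y n ((Fin n → X) × (Fin n → Y))) :
    codeExponent P t (idFun X Y) Φ ≤
      codeExponent P t f (fun n => (Φ n).postcomp fun p => f n p.1 p.2) := by
  refine codeExponent_le_of_errorProb_le P ht le_rfl fun n _ => ?_
  rw [mul_zero, add_zero, one_mul]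
  refine errorProb_mono P _ _ _ _ fun x y hxy => ?_
  exact congrArg (fun p : (Fin n → X) × (Fin n → Y) => f n p.1 p.2) hxy

/-- The rate constraint depends on the encoders only. -/
lemma RateConstraint.congr [Fintype X] [Fintype Y] {P : PMF (X × Y)} {t γ : ℝ} {Z W : ℕ → Type*}
    {Φ : ∀ n, Code X Y n (Z n)} (h : RateConstraint P t γ Φ) {Ψ : ∀ n, Code X Y n (W n)}
    (henc : ∀ n, (Ψ n).enc = (Φ n).enc) : RateConstraint P t γ Ψ := by
  have hlen : ∀ n, avgLength P (Ψ n) = avgLength P (Φ n) := fun n => by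
    simp only [avgLength, henc]
  simpa only [RateConstraint, hlen] using h

end SideInfo

theorem mainTheorem9 {X Y : Type*} [Fintype X] [Fintype Y]
    (P : PMF (X × Y)) (hP : ∀ (a : X) (b : Y), 0 < P (a, b))
    {Z : ℕ → Type*} (f : ∀ n, (Fin n → X) → (Fin n → Y) → Z n)
    (hf : ∀ n, 1 ≤ n → SideInfo.Sensitive (f n))
    (t γ : ℝ) (ht : t ∈ Set.Ioo (0 : ℝ) (1 / 2)) (hγ : 0 < γ) :
    SideInfo.exponentFL P t γ f = SideInfo.exponentSWFL P t γ ∧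
      SideInfo.exponentVL P t γ f = SideInfo.exponentSWVL P t γ := by
  refine ⟨le_antisymm (sSup_le ?_) (sSup_le ?_), le_antisymm (sSup_le ?_) (sSup_le ?_)⟩
  · rintro _ ⟨Φ, hfl, hr, rfl⟩
    refine (SideInfo.codeExponent_toSlepianWolf P hP hf ht.2 Φ).trans (le_sSup ?_)
    -- The encoder is unchanged by definition, so fixed length and rate carry over.
    exact ⟨fun n => (Φ n).toSlepianWolf (f n), hfl, hr.congr fun _ => rfl, rfl⟩
  · rintro _ ⟨Φ, hfl, hr, rfl⟩
    refine (SideInfo.codeExponent_postcomp P f ht.2 Φ).trans (le_sSup ?_)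
    exact ⟨fun n => (Φ n).postcomp fun p => f n p.1 p.2, hfl, hr.congr fun _ => rfl, rfl⟩
  · rintro _ ⟨Φ, hr, rfl⟩
    refine (SideInfo.codeExponent_toSlepianWolf P hP hf ht.2 Φ).trans (le_sSup ?_)
    exact ⟨fun n => (Φ n).toSlepianWolf (f n), hr.congr fun _ => rfl, rfl⟩
  · rintro _ ⟨Φ, hr, rfl⟩
    refine (SideInfo.codeExponent_postcomp P f ht.2 Φ).trans (le_sSup ?_)
    exact ⟨fun n => (Φ n).postcomp fun p => f n p.1 p.2, hr.congr fun _ => rfl, rfl⟩
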